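/- Let $\Omega\subset\mathbb{R}^3$ be a bounded domain (nonempty, open, connected), let $d_\Omega(x)=\operatorname{dist}(x,\partial\Omega)$, and write $\|f\|^2=\int_\Omega|f|^2$ for real scalar or vector functions. Here $\operatorname{rot}$, $\nabla$ and $\operatorname{div}$ of $L_2$-functions are taken in the sense of distributions on $\Omega$, and $\ker\operatorname{rot}=\{k\in L_2(\Omega)^3:\operatorname{rot}k=0\}$. Assume the following. (i) $\Omega$ supports the Hardy inequality: there is a finite constant $H>0$ such that $$\int_\Omega\frac{|u|^2}{d_\Omega^2}\le H\int_\Omega|\nabla u|^2\qquad\text{for all }u\in H^1_0(\Omega)^3,$$ where $H_0^1(\Omega)$ is the closure of $C_c^\infty(\Omega)$ in $H^1(\Omega)$. Let $H_\Omega$ be the best (infimal) such constant. (ii) $\Omega$ supports the Friedrichs–Velte inequality for the rotation: there is a finite constant $\Gamma>0$ such that $\|v\|^2\le\Gamma\|u\|^2$ for all $u\in L_2(\Omega)$ and $v\in L_2(\Omega)^3$ with $\operatorname{rot}v=\nabla u$, $\operatorname{div}v=0$ and $v\perp\ker\operatorname{rot}$ in $L_2(\Omega)^3$. Let $\tilde\Gamma_\Omega$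 be the best (infimal) such constant. Then there is a finite constant $\tilde P>0$, depending only on $\Omega$, such that $$\|v\|^2\le\tilde P\,\|d_\Omega\operatorname{rot}v\|^2$$ for every $v$ in the orthogonal complement of $\ker\operatorname{rot}$ in $L_2(\Omega)^3$, where the right-hand side is understood as $+\infty$ if $\operatorname{rot}v$ is not a locally integrable function or $d_\Omega\operatorname{rot}v\notin L_2(\Omega)^3$. Moreover, there is a least positive constant $\tilde P_\Omega$ with this property, and $$\tilde P_\Omega\le H_\Omega\,(1+\tilde\Gamma_\Omega).$$ -/

import Mathlib

open MeasureTheory Filter Topology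
open scoped ContDiff ENNReal Gradient

namespace RotIneq

noncomputable section

/-- Euclidean three-space. -/
abbrev E3 : Type := EuclideanSpace ℝ (Fin 3)

/-- `d_Ω(x) = dist(x, ∂Ω)`. -/
def bdryDist (Ω : Set E3) (x : E3) : ℝ := Metric.infDist x (frontier Ω)

/-- `‖f‖² = ∫_Ω |f|²`, with value `∞` allowed. -/
def sqNorm {F : Type*} [NormedAddCommGroup F] (Ω : Set E3) (f : E3 → F) : ℝ≥0∞ :=
  ∫⁻ x in Ω, ‖f x‖ₑ ^ 2

/-- `f ∈ L²(Ω; F)`. -/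
def InL2 {F : Type*} [NormedAddCommGroup F] (Ω : Set E3) (f : E3 → F) : Prop :=
  MemLp f 2 (volume.restrict Ω)

/-- Smooth functions with compact support in `Ω`. -/
structure IsTest {F : Type*} [NormedAddCommGroup F] [NormedSpace ℝ F]
    (Ω : Set E3) (φ : E3 → F) : Prop where
  smooth : ContDiff ℝ ∞ φ
  compact : HasCompactSupport φ
  subset : tsupport φ ⊆ Ω

/-- The classical partial derivative `∂ᵢ f`. -/
def pd {F : Type*} [NormedAddCommGroup F] [NormedSpace ℝ F]
    (i : Fin 3) (f : E3 → F) (x : E3) : F :=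
  fderiv ℝ f x (EuclideanSpace.single i 1)

/-- The classical rotation (curl) of a differentiable vector field. -/
def rot (ψ : E3 → E3) (x : E3) : E3 :=
  !₂[pd 1 ψ x 2 - pd 2 ψ x 1, pd 2 ψ x 0 - pd 0 ψ x 2, pd 0 ψ x 1 - pd 1 ψ x 0]

/-- The classical divergence of a differentiable vector field. -/
def dvg (ψ : E3 → E3) (x : E3) : ℝ := ∑ i, pd i ψ x i

/-- `g` is the weak partial derivative `∂ᵢ u` on `Ω`. -/
structure HasWeakPd {F : Type*} [NormedAddCommGroup F] [NormedSpace ℝ F]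
    (Ω : Set E3) (i : Fin 3) (u g : E3 → F) : Prop where
  locInt : LocallyIntegrableOn u Ω
  locInt_deriv : LocallyIntegrableOn g Ω
  eq : ∀ φ : E3 → ℝ, IsTest Ω φ → ∫ x in Ω, pd i φ x • u x = - ∫ x in Ω, φ x • g x

/-- `r` is the weak rotation `rot v` on `Ω`. -/
structure HasWeakRot (Ω : Set E3) (v r : E3 → E3) : Prop where
  locInt : LocallyIntegrableOn v Ω
  locInt_rot : LocallyIntegrableOn r Ω
  eq : ∀ ψ : E3 → E3, IsTest Ω ψ →
    ∫ x in Ω, inner ℝ (v x) (rot ψ x) = ∫ x in Ω, inner ℝ (r x) (ψ x)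

/-- `u ∈ H¹₀(Ω; F)` with weak gradient `G = (∂₀u, ∂₁u, ∂₂u)`: `u` lies in `H¹` and is a limit, in
the `H¹` norm, of smooth functions with compact support in `Ω`. -/
structure InH10 {F : Type*} [NormedAddCommGroup F] [NormedSpace ℝ F]
    (Ω : Set E3) (u : E3 → F) (G : Fin 3 → E3 → F) : Prop where
  memL2 : InL2 Ω u
  memL2_grad : ∀ i, InL2 Ω (G i)
  weak : ∀ i, HasWeakPd Ω i u (G i)
  approx : ∃ φ : ℕ → E3 → F, (∀ k, IsTest Ω (φ k)) ∧
    Tendsto (fun k => sqNorm Ω (u - φ k) + ∑ i, sqNorm Ω (G i - pd i (φ k))) atTop (𝓝 0)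

/-- `v ∈ L²(Ω)³` is orthogonal to the kernel of the (distributional) rotation in `L²(Ω)³`. -/
def OrthKerRot (Ω : Set E3) (v : E3 → E3) : Prop :=
  InL2 Ω v ∧ ∀ k : E3 → E3, InL2 Ω k → HasWeakRot Ω k 0 → ∫ x in Ω, inner ℝ (v x) (k x) = 0

/-- A square integrable pair solving the Moisil–Teodorescu equations `rot v = ∇u`, `div v = 0` on
`Ω` in the sense of distributions. -/
structure IsConjugatePair (Ω : Set E3) (u : E3 → ℝ) (v : E3 → E3) : Prop where
  memL2_u : InL2 Ω u
  memL2_v : InL2 Ω v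
  rot_eq : ∀ ψ : E3 → E3, IsTest Ω ψ →
    ∫ x in Ω, inner ℝ (v x) (rot ψ x) = - ∫ x in Ω, u x * dvg ψ x
  div_eq : ∀ φ : E3 → ℝ, IsTest Ω φ → ∫ x in Ω, inner ℝ (v x) (∇ φ x) = 0

/-- The positive constants `H` with `∫_Ω |u|²/d_Ω² ≤ H ∫_Ω |∇u|²` for all `u ∈ H¹₀(Ω)³`. -/
def hardyConsts (Ω : Set E3) : Set ℝ :=
  {H | 0 < H ∧ ∀ (u : E3 → E3) (G : Fin 3 → E3 → E3), InH10 Ω u G →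
    sqNorm Ω (fun x => (bdryDist Ω x)⁻¹ • u x) ≤ ENNReal.ofReal H * ∑ i, sqNorm Ω (G i)}

/-- The positive constants `Γ` with `‖v‖² ≤ Γ ‖u‖²` for all square integrable conjugate pairs
`(u, v)` with `v` orthogonal to the kernel of the rotation. -/
def friedrichsVelteRotConsts (Ω : Set E3) : Set ℝ :=
  {Γ | 0 < Γ ∧ ∀ (u : E3 → ℝ) (v : E3 → E3), IsConjugatePair Ω u v → OrthKerRot Ω v →
    sqNorm Ω v ≤ ENNReal.ofReal Γ * sqNorm Ω u}

/-- The positive constants `P` with `‖v‖² ≤ P ‖d_Ω rot v‖²` for all `v` in the orthogonal complement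
of the kernel of the rotation in `L²(Ω)³` whose weak rotation is a locally integrable function (for
the other `v` the right-hand side is infinite by convention). -/
def poincareRotConsts (Ω : Set E3) : Set ℝ :=
  {P | 0 < P ∧ ∀ v r : E3 → E3, OrthKerRot Ω v → HasWeakRot Ω v r →
    sqNorm Ω v ≤ ENNReal.ofReal P * sqNorm Ω (fun x => bdryDist Ω x • r x)}

/-- The Hardy constant `H_Ω`. -/
def hardyConst (Ω : Set E3) : ℝ := sInf (hardyConsts Ω)

/-- The Friedrichs–Velte constant for the rotation. -/
def friedrichsVelteRotConst (Ω : Set E3) : ℝ := sInf (friedrichsVelteRotConsts Ω)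

/-- The improved Poincaré constant for the rotation. -/
def poincareRotConst (Ω : Set E3) : ℝ := sInf (poincareRotConsts Ω)

end

end RotIneq

namespace RotIneq

noncomputable section

/-! ### Test functions and their partial derivatives. -/

section Test

variable {F : Type*} [NormedAddCommGroup F] [NormedSpace ℝ F] {Ω : Set E3}

/-! The proof is a Hilbert space duality. Let `K` be the L² closure of the Jacobians of test fields,
with `rot` and `div` acting pointwise on matrices. On `K`, `⟪g, h⟫ = ⟪rot g, rot h⟫ + ⟪div g, div
h⟫` (`setIntegral_grad_inner_grad`, `inner_testJacobians`). For `v ⊥ ker rot`, let `G ∈ K` represent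
`h ↦ ⟪v, rot h⟫` (`exists_riesz_of_inner_eq`). Then `w = v - rot G` satisfies `⟪w, rot h⟫ = ⟪div G,
div h⟫`, so `rot w = ∇u` with `u = -div G`. Both `v` and `rot G` are orthogonal to `ker rot`, hence
so is `w`; since that kernel contains gradients of test functions, `div w = 0`. The Friedrichs–Velte
inequality thus gives `‖w‖² ≤ Γ‖u‖²`.

Expanding `‖w + rot G‖²` yields `‖v‖² ≤ (1 + Γ)‖G‖²` (`norm_sq_le_of_riesz`). Finally `⟪v, rot φ⟫ =
⟪d rot v, φ/d⟫` and Hardy bound `‖G‖` by `√H ‖d rot v‖` (`setIntegral_inner_rot_le`). Only closures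
of test Jacobians occur, so no potential of `G` is needed.

The least constant is the infimum, kept away from zero by one explicit field; taking infima in `P ≤
H(1 + Γ)` gives the final estimate. -/

theorem IsTest.continuous {φ : E3 → F} (h : IsTest Ω φ) : Continuous φ := h.smooth.continuous

theorem IsTest.differentiable {φ : E3 → F} (h : IsTest Ω φ) : Differentiable ℝ φ :=
  h.smooth.differentiable (by simp)

theorem IsTest.pd {φ : E3 → F} (h : IsTest Ω φ) (i : Fin 3) : IsTest Ω (pd i φ) where
  smooth := (h.smooth.fderiv_right (m := ∞) (by simp)).clm_apply contDiff_const
  compact := h.compact.fderiv_apply (𝕜 := ℝ) _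
  subset := (tsupport_fderiv_apply_subset ℝ _).trans h.subset

theorem IsTest.clm_comp {G : Type*} [NormedAddCommGroup G] [NormedSpace ℝ G] {φ : E3 → F}
    (h : IsTest Ω φ) (L : F →L[ℝ] G) : IsTest Ω (fun x => L (φ x)) where
  smooth := L.contDiff.comp h.smooth
  compact := h.compact.comp_left (map_zero L)
  subset := (closure_mono (Function.support_comp_subset (map_zero L) φ)).trans h.subset

theorem IsTest.coord {ψ : E3 → E3} (h : IsTest Ω ψ) (j : Fin 3) : IsTest Ω (fun x => ψ x j) :=
  h.clm_comp (EuclideanSpace.proj j : E3 →L[ℝ] ℝ)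

theorem IsTest.eq_zero {φ : E3 → F} (h : IsTest Ω φ) {x : E3} (hx : x ∉ Ω) : φ x = 0 :=
  image_eq_zero_of_notMem_tsupport fun hx' => hx (h.subset hx')

theorem IsTest.add {φ ψ : E3 → F} (hφ : IsTest Ω φ) (hψ : IsTest Ω ψ) :
    IsTest Ω (φ + ψ) where
  smooth := hφ.smooth.add hψ.smooth
  compact := hφ.compact.add hψ.compact
  subset := (tsupport_add φ ψ).trans (Set.union_subset hφ.subset hψ.subset)

theorem IsTest.const_smul {φ : E3 → F} (hφ : IsTest Ω φ) (c : ℝ) : IsTest Ω (c • φ) :=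
  hφ.clm_comp (c • ContinuousLinearMap.id ℝ F)

theorem IsTest.zero : IsTest Ω (0 : E3 → F) where
  smooth := contDiff_const
  compact := HasCompactSupport.zero
  subset := by simp [tsupport]

theorem IsTest.inL2 {φ : E3 → F} (h : IsTest Ω φ) : InL2 Ω φ :=
  (h.continuous.memLp_of_hasCompactSupport h.compact).restrict Ω

theorem IsTest.locallyIntegrableOn {φ : E3 → F} (h : IsTest Ω φ) : LocallyIntegrableOn φ Ω :=
  (h.continuous.locallyIntegrable).locallyIntegrableOn Ω

theorem pd_coord {ψ : E3 → E3} (h : Differentiable ℝ ψ) (i j : Fin 3) (x : E3) :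
    pd i ψ x j = pd i (fun y => ψ y j) x := by
  have := ((EuclideanSpace.proj j : E3 →L[ℝ] ℝ).hasFDerivAt.comp x (h x).hasFDerivAt).fderiv
  simp only [pd]
  rw [show (fun y => ψ y j) = (EuclideanSpace.proj j : E3 →L[ℝ] ℝ) ∘ ψ from rfl, this]
  rfl

theorem pd_add {φ ψ : E3 → F} (hφ : Differentiable ℝ φ) (hψ : Differentiable ℝ ψ) (i : Fin 3) :
    pd i (φ + ψ) = pd i φ + pd i ψ := by
  funext x
  simp [pd, fderiv_add (hφ x) (hψ x)]

theorem pd_const_smul {φ : E3 → F} (hφ : Differentiable ℝ φ) (c : ℝ) (i : Fin 3) :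
    pd i (c • φ) = c • pd i φ := by
  funext x
  simp [pd, fderiv_const_smul (hφ x) c]

theorem pd_pd_comm {φ : E3 → F} (h : ContDiff ℝ ∞ φ) (i j : Fin 3) :
    pd i (pd j φ) = pd j (pd i φ) := by
  have key : ∀ (a b : Fin 3) (x : E3), pd a (pd b φ) x =
      fderiv ℝ (fderiv ℝ φ) x (EuclideanSpace.single a 1) (EuclideanSpace.single b 1) := by
    intro a b x
    have hd : DifferentiableAt ℝ (fderiv ℝ φ) x :=
      ((h.fderiv_right (m := ∞) (by simp)).differentiable (by simp)) x
    change fderiv ℝ (fun y => fderiv ℝ φ y (EuclideanSpace.single b 1)) x _ = _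
    rw [fderiv_clm_apply hd (differentiableAt_const _)]
    simp
  funext x
  rw [key, key]
  exact (h.contDiffAt.isSymmSndFDerivAt
    (by simpa using WithTop.coe_le_coe.2 (le_top : (2 : ℕ∞) ≤ ⊤))).eq _ _

end Test

/-! ### Integration by parts and the identities of vector calculus. -/

section Parts

variable {Ω : Set E3}

theorem IsTest.integrable_smul {F : Type*} [NormedAddCommGroup F] [NormedSpace ℝ F]
    {f : E3 → ℝ} {g : E3 → F} (hf : IsTest Ω f) (hg : IsTest Ω g) :
    Integrable (fun x => f x • g x) :=
  (hf.continuous.smul hg.continuous).integrable_of_hasCompactSupport hf.compact.smul_right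

theorem IsTest.integrable_mul {f g : E3 → ℝ} (hf : IsTest Ω f) (hg : IsTest Ω g) :
    Integrable (fun x => f x * g x) := hf.integrable_smul hg

theorem setIntegral_pd_smul {F : Type*} [NormedAddCommGroup F] [NormedSpace ℝ F]
    {f : E3 → ℝ} {g : E3 → F} (hf : IsTest Ω f) (hg : IsTest Ω g) (i : Fin 3) :
    ∫ x in Ω, pd i f x • g x = - ∫ x in Ω, f x • pd i g x := by
  rw [setIntegral_eq_integral_of_forall_compl_eq_zero
      (fun x hx => by rw [hg.eq_zero hx, smul_zero]),
    setIntegral_eq_integral_of_forall_compl_eq_zero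
      (fun x hx => by rw [hf.eq_zero hx, zero_smul]), eq_comm, neg_eq_iff_eq_neg]
  exact integral_smul_fderiv_eq_neg_fderiv_smul_of_integrable ((hf.pd i).integrable_smul hg)
    (hf.integrable_smul (hg.pd i)) (hf.integrable_smul hg) (fun x _ => hf.differentiable x)
    (fun x _ => hg.differentiable x)

theorem setIntegral_pd_mul {f g : E3 → ℝ} (hf : IsTest Ω f) (hg : IsTest Ω g) (i : Fin 3) :
    ∫ x in Ω, pd i f x * g x = - ∫ x in Ω, f x * pd i g x := setIntegral_pd_smul hf hg i

/-- Two integrations by parts and the symmetry of second derivatives: the difference of the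
integrands is a null Lagrangian. -/
theorem setIntegral_pd_mul_pd_comm {f g : E3 → ℝ} (hf : IsTest Ω f) (hg : IsTest Ω g)
    (i j : Fin 3) : ∫ x in Ω, pd i f x * pd j g x = ∫ x in Ω, pd j f x * pd i g x := by
  rw [setIntegral_pd_mul hf (hg.pd j), setIntegral_pd_mul hf (hg.pd i), pd_pd_comm hg.smooth]

theorem IsTest.inH10 {φ : E3 → E3} (h : IsTest Ω φ) : InH10 Ω φ (fun i => RotIneq.pd i φ) where
  memL2 := h.inL2
  memL2_grad i := (h.pd i).inL2
  weak i := ⟨h.locallyIntegrableOn, (h.pd i).locallyIntegrableOn,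
    fun _ hf => setIntegral_pd_smul hf h i⟩
  approx := ⟨fun _ => φ, fun _ => h, by simp [sqNorm]⟩

theorem IsTest.rot {ψ : E3 → E3} (h : IsTest Ω ψ) : IsTest Ω (rot ψ) := by
  have hp := fun i j => ((h.pd i).coord j)
  have hs : ∀ x ∉ tsupport ψ, RotIneq.rot ψ x = 0 := fun x hx => by
    have : ∀ i, RotIneq.pd i ψ x = 0 := fun i =>
      image_eq_zero_of_notMem_tsupport fun h' => hx (tsupport_fderiv_apply_subset ℝ _ h')
    ext k
    fin_cases k <;> simp [RotIneq.rot, this]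
  refine ⟨?_, HasCompactSupport.intro h.compact hs, ?_⟩
  · rw [contDiff_euclidean]
    intro k
    fin_cases k
    · exact (hp 1 2).smooth.sub (hp 2 1).smooth
    · exact (hp 2 0).smooth.sub (hp 0 2).smooth
    · exact (hp 0 1).smooth.sub (hp 1 0).smooth
  · refine (closure_minimal (fun x hx => ?_) (isClosed_tsupport ψ)).trans h.subset
    by_contra hx'
    exact hx (hs x hx')

/-- `f` is integrable on `Ω` with vanishing integral. -/
def HasZeroIntegral (Ω : Set E3) (f : E3 → ℝ) : Prop :=
  Integrable f (volume.restrict Ω) ∧ ∫ x in Ω, f x = 0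

theorem HasZeroIntegral.add {f g : E3 → ℝ} (hf : HasZeroIntegral Ω f)
    (hg : HasZeroIntegral Ω g) : HasZeroIntegral Ω (fun x => f x + g x) :=
  ⟨hf.1.add hg.1, by rw [integral_add hf.1 hg.1, hf.2, hg.2, add_zero]⟩

theorem HasZeroIntegral.sub {f g : E3 → ℝ} (hf : HasZeroIntegral Ω f)
    (hg : HasZeroIntegral Ω g) : HasZeroIntegral Ω (fun x => f x - g x) :=
  ⟨hf.1.sub hg.1, by rw [integral_sub hf.1 hg.1, hf.2, hg.2, sub_zero]⟩

theorem HasZeroIntegral.sum {ι : Type*} {s : Finset ι} {f : ι → E3 → ℝ}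
    (hf : ∀ i ∈ s, HasZeroIntegral Ω (f i)) : HasZeroIntegral Ω (fun x => ∑ i ∈ s, f i x) :=
  ⟨integrable_finsetSum _ fun i hi => (hf i hi).1, by
    rw [integral_finsetSum _ fun i hi => (hf i hi).1]
    exact Finset.sum_eq_zero fun i hi => (hf i hi).2⟩

/-- Reduces an integral identity to a pointwise algebraic one modulo a null term. -/
theorem HasZeroIntegral.setIntegral_eq {f g h : E3 → ℝ} (hh : HasZeroIntegral Ω h)
    (hf : Integrable f (volume.restrict Ω)) (heq : ∀ x, f x = g x + h x) :
    ∫ x in Ω, f x = ∫ x in Ω, g x := by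
  have hg : ∀ x, g x = f x - h x := fun x => by rw [heq]; ring
  simp_rw [hg]
  rw [integral_sub hf hh.1, hh.2, sub_zero]

theorem hasZeroIntegral_parts {f g : E3 → ℝ} (hf : IsTest Ω f) (hg : IsTest Ω g) (i : Fin 3) :
    HasZeroIntegral Ω (fun x => f x * pd i g x + pd i f x * g x) := by
  have h1 := (hf.integrable_mul (hg.pd i)).restrict (s := Ω)
  have h2 := ((hf.pd i).integrable_mul hg).restrict (s := Ω)
  exact ⟨h1.add h2, by rw [integral_add h1 h2, setIntegral_pd_mul hf hg, add_neg_cancel]⟩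

theorem hasZeroIntegral_pd_mul_pd {f g : E3 → ℝ} (hf : IsTest Ω f) (hg : IsTest Ω g)
    (i j : Fin 3) : HasZeroIntegral Ω (fun x => pd i f x * pd j g x - pd j f x * pd i g x) := by
  have h1 := ((hf.pd i).integrable_mul (hg.pd j)).restrict (s := Ω)
  have h2 := ((hf.pd j).integrable_mul (hg.pd i)).restrict (s := Ω)
  exact ⟨h1.sub h2, by rw [integral_sub h1 h2, setIntegral_pd_mul_pd_comm hf hg, sub_self]⟩

theorem IsTest.integrable_inner {φ ψ : E3 → E3} (hφ : IsTest Ω φ) (hψ : IsTest Ω ψ) :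
    Integrable (fun x => inner ℝ (φ x) (ψ x)) (volume.restrict Ω) :=
  ((hφ.continuous.inner hψ.continuous).integrable_of_hasCompactSupport
    (hψ.compact.mono fun x hx h0 => hx (by simp [h0]))).restrict

theorem real_inner_E3 (a b : E3) : inner ℝ a b = a 0 * b 0 + a 1 * b 1 + a 2 * b 2 := by
  simp [PiLp.inner_apply, Fin.sum_univ_three, mul_comm]

/-- The gradient of a test function lies in the kernel of the rotation. -/
theorem setIntegral_gradient_inner_rot {φ : E3 → ℝ} {ψ : E3 → E3} (hφ : IsTest Ω φ)
    (hψ : IsTest Ω ψ) : ∫ x in Ω, inner ℝ (∇ φ x) (rot ψ x) = 0 := by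
  have hg : ∀ x i, (∇ φ x) i = pd i φ x := fun x i => by
    have : (∇ φ x) i = inner ℝ (∇ φ x) (EuclideanSpace.single i 1) := by
      rw [EuclideanSpace.inner_single_right]
      simp
    rw [this, gradient, InnerProductSpace.toDual_symm_apply]
    rfl
  have hD := fun i j k => hasZeroIntegral_pd_mul_pd hφ (hψ.coord k) i j
  have : ∀ x, inner ℝ (∇ φ x) (rot ψ x) =
      (pd 0 φ x * pd 1 (fun y => ψ y 2) x - pd 1 φ x * pd 0 (fun y => ψ y 2) x) +
      (pd 1 φ x * pd 2 (fun y => ψ y 0) x - pd 2 φ x * pd 1 (fun y => ψ y 0) x) +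
      (pd 2 φ x * pd 0 (fun y => ψ y 1) x - pd 0 φ x * pd 2 (fun y => ψ y 1) x) := fun x => by
    simp only [real_inner_E3, hg, rot, pd_coord hψ.differentiable]
    simp
    ring
  simp_rw [this]
  exact (((hD 0 1 2).add (hD 1 2 0)).add (hD 2 0 1)).2

theorem hasWeakRot_gradient {φ : E3 → ℝ} (hφ : IsTest Ω φ) : HasWeakRot Ω (∇ φ) 0 where
  locInt := by
    have : Continuous (∇ φ) := (InnerProductSpace.toDual ℝ E3).symm.continuous.comp
      (hφ.smooth.continuous_fderiv (by simp))
    exact this.locallyIntegrable.locallyIntegrableOn Ω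
  locInt_rot :=
    (continuous_const : Continuous (0 : E3 → E3)).locallyIntegrable.locallyIntegrableOn Ω
  eq ψ hψ := by rw [setIntegral_gradient_inner_rot hφ hψ]; simp

theorem inL2_gradient {φ : E3 → ℝ} (hφ : IsTest Ω φ) : InL2 Ω (∇ φ) := by
  have hc : Continuous (∇ φ) := (InnerProductSpace.toDual ℝ E3).symm.continuous.comp
    (hφ.smooth.continuous_fderiv (by simp))
  have hs : HasCompactSupport (∇ φ) := (hφ.compact.fderiv (𝕜 := ℝ)).comp_left (map_zero _)
  exact (hc.memLp_of_hasCompactSupport hs).restrict Ω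

/-- The classical rotation of a test field is its weak rotation. -/
theorem IsTest.hasWeakRot {v : E3 → E3} (hv : IsTest Ω v) : HasWeakRot Ω v (RotIneq.rot v) where
  locInt := hv.locallyIntegrableOn
  locInt_rot := hv.rot.locallyIntegrableOn
  eq ψ hψ := by
    have hD := fun i j k => (hasZeroIntegral_parts (hv.coord i) (hψ.coord k) j).sub
      (hasZeroIntegral_parts (hv.coord k) (hψ.coord i) j)
    refine (((hD 0 1 2).add (hD 1 2 0)).add (hD 2 0 1)).setIntegral_eq
      (hv.integrable_inner hψ.rot) fun x => ?_
    simp only [real_inner_E3, RotIneq.rot, pd_coord hψ.differentiable, pd_coord hv.differentiable]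
    simp
    ring

/-- `∫ ∇ψ : ∇φ = ∫ rot ψ · rot φ + ∫ div ψ div φ` for test fields. -/
theorem setIntegral_grad_inner_grad {ψ φ : E3 → E3} (hψ : IsTest Ω ψ) (hφ : IsTest Ω φ) :
    ∫ x in Ω, ∑ i, inner ℝ (pd i ψ x) (pd i φ x) =
      ∫ x in Ω, (inner ℝ (rot ψ x) (rot φ x) + dvg ψ x * dvg φ x) := by
  -- Pointwise, `∇ψ : ∇φ` exceeds `rot ψ · rot φ + div ψ div φ` by exactly this sum of null
  -- Lagrangians.
  have hD : HasZeroIntegral Ω (fun x => ∑ i, ∑ j,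
      (pd i (fun y => ψ y j) x * pd j (fun y => φ y i) x -
        pd j (fun y => ψ y j) x * pd i (fun y => φ y i) x)) :=
    .sum fun i _ => .sum fun j _ => hasZeroIntegral_pd_mul_pd (hψ.coord j) (hφ.coord i) i j
  refine hD.setIntegral_eq
    (integrable_finsetSum _ fun i _ => (hψ.pd i).integrable_inner (hφ.pd i)) fun x => ?_
  simp only [real_inner_E3, rot, dvg, pd_coord hψ.differentiable, pd_coord hφ.differentiable,
    Fin.sum_univ_three]
  simp
  ring

end Parts

/-! ### The abstract duality argument. -/

section Hilbert

variable {X Y Z : Type*} [NormedAddCommGroup X] [InnerProductSpace ℝ X]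
  [NormedAddCommGroup Y] [InnerProductSpace ℝ Y]
  [NormedAddCommGroup Z] [InnerProductSpace ℝ Z]

/-- The Riesz representative `G` of `h ↦ ⟪v, A h⟫` in the closure of a subspace on which
`⟪g, h⟫ = ⟪A g, A h⟫ + ⟪T g, T h⟫`. -/
theorem exists_riesz_of_inner_eq [CompleteSpace X] [CompleteSpace Y] (A : X →L[ℝ] Y)
    (T : X →L[ℝ] Z) (S : Submodule ℝ X)
    (hS : ∀ g ∈ S, ∀ h ∈ S, inner ℝ g h = inner ℝ (A g) (A h) + inner ℝ (T g) (T h)) (v : Y) :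
    ∃ G ∈ S.topologicalClosure, (∀ h ∈ S.topologicalClosure, inner ℝ G h = inner ℝ v (A h)) ∧
      ∀ h ∈ S.topologicalClosure, inner ℝ (v - A G) (A h) = inner ℝ (T G) (T h) := by
  set K := S.topologicalClosure
  -- The identity passes to the closure one argument at a time.
  have hK1 : ∀ g ∈ S, ∀ h ∈ K, inner ℝ g h = inner ℝ (A g) (A h) + inner ℝ (T g) (T h) := by
    intro g hg
    exact closure_minimal (t := {h | inner ℝ g h = inner ℝ (A g) (A h) + inner ℝ (T g) (T h)})
      (hS g hg) (isClosed_eq (by fun_prop) (by fun_prop))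
  have hK : ∀ g ∈ K, ∀ h ∈ K, inner ℝ g h = inner ℝ (A g) (A h) + inner ℝ (T g) (T h) := by
    intro g hg h hh
    exact closure_minimal (t := {g | inner ℝ g h = inner ℝ (A g) (A h) + inner ℝ (T g) (T h)})
      (fun g hg => hK1 g hg h hh) (isClosed_eq (by fun_prop) (by fun_prop)) hg
  have hc : IsClosed (K : Set X) := S.isClosed_topologicalClosure
  have : CompleteSpace K := hc.completeSpace_coe
  -- The representative is the orthogonal projection of `A* v` onto `K`.
  have hG : ∀ h ∈ K, inner ℝ (K.starProjection (A.adjoint v)) h = inner ℝ v (A h) := by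
    intro h hh
    have := K.starProjection_inner_eq_zero (A.adjoint v) h hh
    rw [inner_sub_left, ContinuousLinearMap.adjoint_inner_left] at this
    linarith
  refine ⟨_, K.starProjection_apply_mem (A.adjoint v), hG, fun h hh => ?_⟩
  have h1 := hG h hh
  have h2 := hK _ (K.starProjection_apply_mem (A.adjoint v)) h hh
  rw [inner_sub_left]
  linarith

/-- With `w = v - A G`, testing at `h = G` gives `⟪w, A G⟫ = ‖T G‖²`, so `‖v‖² = ‖w‖² + 2‖T G‖² + ‖A
G‖²`. Bounding `‖w‖²` by `Γ‖T G‖²` and one copy of `‖T G‖²` by `Γ‖A G‖²` leaves `(1 + Γ)(‖A G‖² + ‖T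
G‖²) = (1 + Γ)‖G‖²`. -/
theorem norm_sq_le_of_riesz {A : X →L[ℝ] Y} {T : X →L[ℝ] Z} {S : Submodule ℝ X} {v : Y} {G : X}
    (hG : G ∈ S.topologicalClosure)
    (hGv : ∀ h ∈ S.topologicalClosure, inner ℝ G h = inner ℝ v (A h))
    (hGw : ∀ h ∈ S.topologicalClosure, inner ℝ (v - A G) (A h) = inner ℝ (T G) (T h))
    {Γ c : ℝ} (hΓ : 0 ≤ Γ) (hw : ‖v - A G‖ ^ 2 ≤ Γ * ‖T G‖ ^ 2)
    (hc : ∀ h ∈ S, inner ℝ v (A h) ≤ c * ‖h‖) (hc0 : 0 ≤ c) : ‖v‖ ^ 2 ≤ (1 + Γ) * c ^ 2 := by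
  have hcG : inner ℝ v (A G) ≤ c * ‖G‖ :=
    closure_minimal (t := {h | inner ℝ v (A h) ≤ c * ‖h‖}) hc
      (isClosed_le (by fun_prop) (by fun_prop)) hG
  have e1 : inner ℝ v (A G) = ‖G‖ ^ 2 := by rw [← hGv G hG, real_inner_self_eq_norm_sq]
  have e2 : inner ℝ (v - A G) (A G) = ‖T G‖ ^ 2 := by
    rw [hGw G hG, real_inner_self_eq_norm_sq]
  have e3 : ‖G‖ ^ 2 = ‖A G‖ ^ 2 + ‖T G‖ ^ 2 := by
    rw [inner_sub_left, e1, real_inner_self_eq_norm_sq] at e2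
    linarith
  have e4 : ‖v‖ ^ 2 = ‖v - A G‖ ^ 2 + 2 * ‖T G‖ ^ 2 + ‖A G‖ ^ 2 := by
    conv_lhs => rw [← sub_add_cancel v (A G), norm_add_sq_real, e2]
  -- Cauchy–Schwarz, squared and combined with `hw`, bounds `‖T G‖⁴` by `Γ‖T G‖²‖A G‖²`; a factor
  -- `‖T G‖²` then cancels.
  have e5 : ‖T G‖ ^ 2 ≤ ‖v - A G‖ * ‖A G‖ := e2 ▸ real_inner_le_norm _ _
  have e6 : ‖T G‖ ^ 2 ≤ Γ * ‖A G‖ ^ 2 := by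
    rcases (sq_nonneg ‖T G‖).eq_or_lt with h | h
    · rw [← h]; positivity
    · have h1 : (‖T G‖ ^ 2) ^ 2 ≤ ‖v - A G‖ ^ 2 * ‖A G‖ ^ 2 := by
        rw [← mul_pow]; exact pow_le_pow_left₀ h.le e5 2
      have h2 : ‖v - A G‖ ^ 2 * ‖A G‖ ^ 2 ≤ Γ * ‖T G‖ ^ 2 * ‖A G‖ ^ 2 :=
        mul_le_mul_of_nonneg_right hw (sq_nonneg _)
      refine le_of_mul_le_mul_left ?_ h
      linarith
  have e7 : ‖G‖ ≤ c := by
    rcases (norm_nonneg G).eq_or_lt with h | h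
    · rwa [← h]
    · refine le_of_mul_le_mul_right ?_ h
      linarith
  have e8 : ‖G‖ ^ 2 ≤ c ^ 2 := pow_le_pow_left₀ (norm_nonneg _) e7 2
  have e9 := mul_le_mul_of_nonneg_left e8 (by linarith : 0 ≤ 1 + Γ)
  rw [e3] at e9
  linarith

end Hilbert

/-! ### Test Jacobians as a subspace of L². -/

section L2

variable {Ω : Set E3}

/-- Triples of vectors, with the Euclidean (Frobenius) norm. -/
abbrev Mat3 : Type := PiLp 2 (fun _ : Fin 3 => E3)

/-- The triple `(∂₀φ, ∂₁φ, ∂₂φ)`. -/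
def jacobian (φ : E3 → E3) (x : E3) : Mat3 := WithLp.toLp 2 fun i => pd i φ x

/-- The entry `∂ᵢφⱼ` as a linear map of the partial derivatives. -/
def entry (i j : Fin 3) : Mat3 →L[ℝ] ℝ :=
  (EuclideanSpace.proj j : E3 →L[ℝ] ℝ).comp (PiLp.proj 2 (fun _ : Fin 3 => E3) i)

/-- The rotation as a linear map of the partial derivatives. -/
def rotPart : Mat3 →L[ℝ] E3 :=
  (PiLp.continuousLinearEquiv 2 ℝ (fun _ : Fin 3 => ℝ)).symm.toContinuousLinearMap.comp
    (ContinuousLinearMap.pi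
      ![entry 1 2 - entry 2 1, entry 2 0 - entry 0 2, entry 0 1 - entry 1 0])

/-- The divergence as a linear map of the partial derivatives. -/
def divPart : Mat3 →L[ℝ] ℝ := ∑ i, entry i i

theorem rotPart_jacobian (φ : E3 → E3) (x : E3) : rotPart (jacobian φ x) = rot φ x := by
  ext k
  fin_cases k <;> rfl

theorem divPart_jacobian (φ : E3 → E3) (x : E3) : divPart (jacobian φ x) = dvg φ x := by
  simp only [divPart, dvg, sum_apply]
  rfl

theorem sqNorm_eq_eLpNorm_sq {F : Type*} [NormedAddCommGroup F] (f : E3 → F) :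
    sqNorm Ω f = eLpNorm f 2 (volume.restrict Ω) ^ 2 := by
  have := eLpNorm_nnreal_pow_eq_lintegral (μ := volume.restrict Ω) (f := f)
    (two_ne_zero : (2 : NNReal) ≠ 0)
  simpa [sqNorm] using this.symm

theorem sqNorm_eq_of_ae {F : Type*} [NormedAddCommGroup F] {f : E3 → F}
    {g : Lp F 2 (volume.restrict Ω)} (h : g =ᵐ[volume.restrict Ω] f) :
    sqNorm Ω f = ENNReal.ofReal (‖g‖ ^ 2) := by
  rw [sqNorm_eq_eLpNorm_sq, ← eLpNorm_congr_ae h, Lp.norm_def, ENNReal.ofReal_pow ENNReal.toReal_nonneg,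
    ENNReal.ofReal_toReal (Lp.eLpNorm_ne_top g)]

theorem sqNorm_eq_of_inL2 {F : Type*} [NormedAddCommGroup F] {f : E3 → F} (h : InL2 Ω f) :
    sqNorm Ω f = ENNReal.ofReal (‖h.toLp f‖ ^ 2) := sqNorm_eq_of_ae h.coeFn_toLp

theorem inL2_of_sqNorm_ne_top {F : Type*} [NormedAddCommGroup F] {f : E3 → F}
    (hf : AEStronglyMeasurable f (volume.restrict Ω)) (h : sqNorm Ω f ≠ ⊤) : InL2 Ω f := by
  refine ⟨hf, ?_⟩
  rw [sqNorm_eq_eLpNorm_sq] at h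
  exact lt_top_iff_ne_top.2 fun h' => h (by simp [h'])

theorem inner_eq_of_ae {F : Type*} [NormedAddCommGroup F] [InnerProductSpace ℝ F]
    {f g : Lp F 2 (volume.restrict Ω)} {f' g' : E3 → F} (hf : f =ᵐ[volume.restrict Ω] f')
    (hg : g =ᵐ[volume.restrict Ω] g') : inner ℝ f g = ∫ x in Ω, inner ℝ (f' x) (g' x) := by
  rw [L2.inner_def]
  refine integral_congr_ae ?_
  filter_upwards [hf, hg] with x h1 h2
  rw [h1, h2]

theorem sqNorm_jacobian {φ : E3 → E3} (hφ : IsTest Ω φ) :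
    sqNorm Ω (jacobian φ) = ∑ i, sqNorm Ω (pd i φ) := by
  have : ∀ x, ‖jacobian φ x‖ₑ ^ 2 = ∑ i, ‖pd i φ x‖ₑ ^ 2 := fun x => by
    simp only [← ofReal_norm, ← ENNReal.ofReal_pow (norm_nonneg _)]
    rw [← ENNReal.ofReal_sum_of_nonneg fun _ _ => sq_nonneg _, PiLp.norm_sq_eq_of_L2]
    rfl
  simp_rw [sqNorm, this]
  exact lintegral_finsetSum _ fun i _ => ((hφ.pd i).continuous.enorm.measurable).pow_const 2

theorem jacobian_inL2 {φ : E3 → E3} (hφ : IsTest Ω φ) : InL2 Ω (jacobian φ) := by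
  have hc : Continuous (jacobian φ) :=
    (PiLp.continuous_toLp 2 _).comp (continuous_pi fun i => (hφ.pd i).continuous)
  refine inL2_of_sqNorm_ne_top hc.aestronglyMeasurable ?_
  rw [sqNorm_jacobian hφ]
  refine ENNReal.sum_ne_top.2 fun i _ => ?_
  rw [sqNorm_eq_of_inL2 (hφ.pd i).inL2]
  exact ENNReal.ofReal_ne_top

/-- The subspace of `L²` formed by the derivatives of test fields. -/
def testJacobians (Ω : Set E3) : Submodule ℝ (Lp Mat3 2 (volume.restrict Ω)) where
  carrier := {g | ∃ φ, IsTest Ω φ ∧ g =ᵐ[volume.restrict Ω] jacobian φ}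
  add_mem' := by
    rintro f g ⟨φ, hφ, hf⟩ ⟨ψ, hψ, hg⟩
    refine ⟨φ + ψ, hφ.add hψ, ?_⟩
    filter_upwards [Lp.coeFn_add f g, hf, hg] with x h1 h2 h3
    rw [h1, Pi.add_apply, h2, h3]
    simp only [jacobian, pd_add hφ.differentiable hψ.differentiable]
    rfl
  zero_mem' := by
    refine ⟨0, IsTest.zero, ?_⟩
    filter_upwards [Lp.coeFn_zero Mat3 2 (volume.restrict Ω)] with x h1
    rw [h1]
    ext i : 1
    simp [jacobian, pd]
  smul_mem' := by
    rintro c f ⟨φ, hφ, hf⟩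
    refine ⟨c • φ, hφ.const_smul c, ?_⟩
    filter_upwards [Lp.coeFn_smul c f, hf] with x h1 h2
    rw [h1, Pi.smul_apply, h2]
    simp only [jacobian, pd_const_smul hφ.differentiable]
    rfl

theorem compLpL_ae {F G : Type*} [NormedAddCommGroup F] [NormedSpace ℝ F] [NormedAddCommGroup G]
    [NormedSpace ℝ G] (L : F →L[ℝ] G) {g : Lp F 2 (volume.restrict Ω)} {f : E3 → F}
    (h : g =ᵐ[volume.restrict Ω] f) :
    L.compLpL 2 (volume.restrict Ω) g =ᵐ[volume.restrict Ω] fun x => L (f x) := by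
  filter_upwards [L.coeFn_compLpL g, h] with x h1 h2
  rw [h1, h2]

theorem inner_testJacobians {g h : Lp Mat3 2 (volume.restrict Ω)} (hg : g ∈ testJacobians Ω)
    (hh : h ∈ testJacobians Ω) :
    inner ℝ g h = inner ℝ (rotPart.compLpL 2 _ g) (rotPart.compLpL 2 _ h) +
      inner ℝ (divPart.compLpL 2 _ g) (divPart.compLpL 2 _ h) := by
  obtain ⟨ψ, hψ, hg⟩ := hg
  obtain ⟨φ, hφ, hh⟩ := hh
  have hr := compLpL_ae rotPart hg
  have hr' := compLpL_ae rotPart hh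
  have hd := compLpL_ae divPart hg
  have hd' := compLpL_ae divPart hh
  rw [L2.inner_def (rotPart.compLpL 2 _ g), L2.inner_def (divPart.compLpL 2 _ g),
    ← integral_add (L2.integrable_inner _ _) (L2.integrable_inner _ _), inner_eq_of_ae hg hh]
  refine (setIntegral_grad_inner_grad hψ hφ).trans (integral_congr_ae ?_)
  filter_upwards [hr, hr', hd, hd'] with x h1 h2 h3 h4
  rw [h1, h2, h3, h4]
  simp [rotPart_jacobian, divPart_jacobian, mul_comm]

/-! ### The weighted estimate and the Poincaré inequality. -/

theorem bdryDist_pos (hopen : IsOpen Ω) (hne : Ω.Nonempty) (hbdd : Bornology.IsBounded Ω) {x : E3}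
    (hx : x ∈ Ω) : 0 < bdryDist Ω x := by
  have hfr : (frontier Ω).Nonempty := by
    rw [Set.nonempty_iff_ne_empty, Ne, frontier_eq_empty_iff]
    rintro (h | h)
    · exact hne.ne_empty h
    · exact NormedSpace.unbounded_univ ℝ E3 (h ▸ hbdd)
  refine (isClosed_frontier.notMem_iff_infDist_pos hfr).1 fun h => ?_
  rw [hopen.frontier_eq] at h
  exact h.2 hx

/-- A test field pairs with the rotation of `v` with the weighted norms. -/
theorem setIntegral_inner_rot_le (hopen : IsOpen Ω) (hne : Ω.Nonempty)
    (hbdd : Bornology.IsBounded Ω) {H : ℝ} (hH : H ∈ hardyConsts Ω) {v r : E3 → E3}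
    (hr : HasWeakRot Ω v r) (hdr : InL2 Ω (fun x => bdryDist Ω x • r x)) {φ : E3 → E3}
    (hφ : IsTest Ω φ) {g : Lp Mat3 2 (volume.restrict Ω)}
    (hg : g =ᵐ[volume.restrict Ω] jacobian φ) :
    ∫ x in Ω, inner ℝ (v x) (rot φ x) ≤ √H * ‖hdr.toLp _‖ * ‖g‖ := by
  have hcont : Continuous (bdryDist Ω) := Metric.continuous_infDist_pt _
  have hm : AEStronglyMeasurable (fun x => (bdryDist Ω x)⁻¹ • φ x) (volume.restrict Ω) :=
    (hcont.measurable.inv.smul hφ.continuous.measurable).aestronglyMeasurable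
  have hle := hH.2 φ _ hφ.inH10
  rw [← sqNorm_jacobian hφ, sqNorm_eq_of_ae hg, ← ENNReal.ofReal_mul hH.1.le] at hle
  have hq : InL2 Ω (fun x => (bdryDist Ω x)⁻¹ • φ x) :=
    inL2_of_sqNorm_ne_top hm (ne_top_of_le_ne_top ENNReal.ofReal_ne_top hle)
  rw [sqNorm_eq_of_inL2 hq, ENNReal.ofReal_le_ofReal_iff (by have := hH.1; positivity)] at hle
  have hle' : ‖hq.toLp _‖ ≤ √H * ‖g‖ := by
    rw [← Real.sqrt_sq (norm_nonneg g), ← Real.sqrt_mul hH.1.le]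
    exact Real.le_sqrt_of_sq_le hle
  calc ∫ x in Ω, inner ℝ (v x) (rot φ x) = ∫ x in Ω, inner ℝ (r x) (φ x) := hr.eq φ hφ
    _ = ∫ x in Ω, inner ℝ (bdryDist Ω x • r x) ((bdryDist Ω x)⁻¹ • φ x) := by
      -- The weights cancel because `d` is positive on `Ω`.
      refine setIntegral_congr_fun hopen.measurableSet fun x hx => ?_
      have := (bdryDist_pos hopen hne hbdd hx).ne'
      simp only [real_inner_smul_left, real_inner_smul_right]
      field_simp
    _ = inner ℝ (hdr.toLp _) (hq.toLp _) :=
      (inner_eq_of_ae hdr.coeFn_toLp hq.coeFn_toLp).symm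
    _ ≤ ‖hdr.toLp _‖ * ‖hq.toLp _‖ := real_inner_le_norm _ _
    _ ≤ ‖hdr.toLp _‖ * (√H * ‖g‖) := by gcongr
    _ = √H * ‖hdr.toLp _‖ * ‖g‖ := by ring

theorem mul_one_add_mem_poincareRotConsts (hopen : IsOpen Ω) (hne : Ω.Nonempty)
    (hbdd : Bornology.IsBounded Ω) {H Γ : ℝ} (hH : H ∈ hardyConsts Ω)
    (hΓ : Γ ∈ friedrichsVelteRotConsts Ω) : H * (1 + Γ) ∈ poincareRotConsts Ω := by
  have hP : 0 < H * (1 + Γ) := mul_pos hH.1 (by linarith [hΓ.1])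
  refine ⟨hP, fun v r hv hr => ?_⟩
  by_cases hfin : sqNorm Ω (fun x => bdryDist Ω x • r x) = ⊤
  · rw [hfin, ENNReal.mul_top (by simpa using hP)]
    exact le_top
  have hcont : Continuous (bdryDist Ω) := Metric.continuous_infDist_pt _
  have hdr : InL2 Ω (fun x => bdryDist Ω x • r x) := inL2_of_sqNorm_ne_top
    (hcont.aestronglyMeasurable.smul hr.locInt_rot.aestronglyMeasurable) hfin
  have hvL : InL2 Ω v := hv.1
  have hvae := hvL.coeFn_toLp
  obtain ⟨G, hG, hGv, hGw⟩ := exists_riesz_of_inner_eq (rotPart.compLpL 2 (volume.restrict Ω))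
    (divPart.compLpL 2 (volume.restrict Ω)) (testJacobians Ω)
    (fun g hg h hh => inner_testJacobians hg hh) (hvL.toLp v)
  set w := hvL.toLp v - rotPart.compLpL 2 (volume.restrict Ω) G with hwdef
  set u := divPart.compLpL 2 (volume.restrict Ω) G with hudef
  have hker : ∀ k : E3 → E3, InL2 Ω k → HasWeakRot Ω k 0 →
      ∫ x in Ω, inner ℝ (w x) (k x) = 0 := by
    intro k hk hk0
    rw [← inner_eq_of_ae (ae_eq_refl _) hk.coeFn_toLp, hwdef, inner_sub_left,
      inner_eq_of_ae hvae hk.coeFn_toLp, hv.2 k hk hk0, zero_sub, neg_eq_zero]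
    -- Orthogonality of `rot G` to `k` is a closed condition on `G`; on test Jacobians it is the
    -- definition of `rot k = 0`.
    refine closure_minimal (t := {h | inner ℝ (rotPart.compLpL 2 (volume.restrict Ω) h)
      (hk.toLp k) = 0}) ?_ (isClosed_eq (by fun_prop) (by fun_prop)) hG
    rintro h ⟨φ, hφ, hh⟩
    have := hk0.eq φ hφ
    simp only [Pi.zero_apply, inner_zero_left, integral_zero] at this
    rw [Set.mem_ofPred_eq, real_inner_comm, inner_eq_of_ae hk.coeFn_toLp (compLpL_ae rotPart hh)]
    exact this
  -- The minus sign comes from the weak gradient: `∇p` acts on `ψ` as `-∫ p div ψ`.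
  have hpair : IsConjugatePair Ω (fun x => - u x) w := by
    refine ⟨(Lp.memLp u).neg, Lp.memLp w, fun ψ hψ => ?_, fun φ hφ => ?_⟩
    · have hj := (jacobian_inL2 hψ).coeFn_toLp
      have := hGw _ (Submodule.le_topologicalClosure _ ⟨ψ, hψ, hj⟩)
      rw [inner_eq_of_ae (ae_eq_refl _) (compLpL_ae rotPart hj),
        inner_eq_of_ae (ae_eq_refl _) (compLpL_ae divPart hj)] at this
      simp only [rotPart_jacobian, divPart_jacobian] at this
      rw [this, ← integral_neg]
      refine integral_congr_ae (.of_forall fun x => ?_)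
      simp [hudef, mul_comm]
    · exact hker _ (inL2_gradient hφ) (hasWeakRot_gradient hφ)
  have hFV := hΓ.2 _ _ hpair ⟨Lp.memLp w, hker⟩
  have hun : sqNorm Ω (fun x => - u x) = sqNorm Ω u := by simp [sqNorm]
  rw [hun, sqNorm_eq_of_ae (ae_eq_refl _), sqNorm_eq_of_ae (ae_eq_refl _),
    ← ENNReal.ofReal_mul hΓ.1.le,
    ENNReal.ofReal_le_ofReal_iff (by have := hΓ.1; positivity)] at hFV
  have hfinal := norm_sq_le_of_riesz hG hGv hGw hΓ.1.le hFV (c := √H * ‖hdr.toLp _‖)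
    (by
      rintro h ⟨φ, hφ, hh⟩
      rw [inner_eq_of_ae hvae (compLpL_ae rotPart hh)]
      exact setIntegral_inner_rot_le hopen hne hbdd hH hr hdr hφ hh) (by positivity)
  rw [sqNorm_eq_of_inL2 hvL, sqNorm_eq_of_inL2 hdr, ← ENNReal.ofReal_mul hP.le]
  refine ENNReal.ofReal_le_ofReal (hfinal.trans_eq ?_)
  rw [mul_pow, Real.sq_sqrt hH.1.le]
  ring

end L2

/-! ### Existence of the least constant and passage to infima. -/

section Least

variable {Ω : Set E3}

/-- The velocity field of the rotation about the last axis, as a linear map. -/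
def spin : E3 →L[ℝ] E3 :=
  LinearMap.toContinuousLinearMap
    { toFun := fun x => !₂[- x 1, x 0, 0]
      map_add' := fun x y => by ext k; fin_cases k <;> simp; ring
      map_smul' := fun c x => by ext k; fin_cases k <;> simp }

theorem exists_isTest_rot_ne_zero (hopen : IsOpen Ω) (hne : Ω.Nonempty) :
    ∃ φ : E3 → E3, IsTest Ω φ ∧ ∃ x ∈ Ω, rot φ x ≠ 0 := by
  obtain ⟨x₀, hx₀⟩ := hne
  obtain ⟨f, hf, hf1⟩ : ∃ f : E3 → ℝ, IsTest Ω f ∧ f =ᶠ[𝓝 x₀] 1 := by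
    obtain ⟨ε, hε, hball⟩ := Metric.isOpen_iff.1 hopen x₀ hx₀
    let b : ContDiffBump x₀ := ⟨ε / 4, ε / 2, by positivity, by linarith⟩
    refine ⟨b, ⟨b.contDiff, b.hasCompactSupport, ?_⟩, b.eventuallyEq_one⟩
    rw [b.tsupport_eq]
    exact (Metric.closedBall_subset_ball (by change ε / 2 < ε; linarith)).trans hball
  -- A cut-off rigid rotation: near `x₀` its rotation has last component `2`.
  refine ⟨fun x => f x • spin x, ⟨hf.smooth.smul spin.contDiff, hf.compact.smul_right,
    (tsupport_smul_subset_left f _).trans hf.subset⟩, x₀, hx₀, fun h => ?_⟩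
  have hev : (fun x => f x • spin x) =ᶠ[𝓝 x₀] spin := by
    filter_upwards [hf1] with x hx
    simp [hx]
  have hpd : ∀ i, pd i (fun x => f x • spin x) x₀ = spin (EuclideanSpace.single i 1) := fun i => by
    rw [pd, hev.fderiv_eq, spin.fderiv]
  have h2 : spin (EuclideanSpace.single 0 1) 1 - spin (EuclideanSpace.single 1 1) 0 = 0 := by
    rw [← hpd, ← hpd]
    exact congrArg (fun y : E3 => y 2) h
  norm_num [spin] at h2

theorem sqNorm_ne_zero {φ : E3 → E3} (hopen : IsOpen Ω) (hφ : Continuous φ) {x : E3}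
    (hx : x ∈ Ω) (hne : φ x ≠ 0) : sqNorm Ω φ ≠ 0 := by
  intro h
  rw [sqNorm, lintegral_eq_zero_iff (hφ.enorm.measurable.pow_const 2)] at h
  have h0 : φ =ᵐ[volume.restrict Ω] 0 := by
    filter_upwards [h] with y hy
    simpa using hy
  exact hne (Measure.eqOn_open_of_ae_eq h0 hopen hφ.continuousOn continuousOn_const hx)

/-- Testing the weak equation `rot k = 0` against `φ` is the required orthogonality. -/
theorem orthKerRot_rot {φ : E3 → E3} (hφ : IsTest Ω φ) : OrthKerRot Ω (rot φ) := by
  refine ⟨hφ.rot.inL2, fun k _ hk => ?_⟩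
  have := hk.eq φ hφ
  simp only [Pi.zero_apply, inner_zero_left, integral_zero] at this
  simpa only [real_inner_comm] using this

/-- The single field `rot φ ≠ 0` gives the bound `c = ‖rot φ‖² / ‖d rot rot φ‖²`. Any admissible
constant forces the denominator to be nonzero. -/
theorem exists_pos_le_poincareRotConsts (hopen : IsOpen Ω) (hne : Ω.Nonempty)
    (hP : (poincareRotConsts Ω).Nonempty) : ∃ c > 0, ∀ P ∈ poincareRotConsts Ω, c ≤ P := by
  obtain ⟨φ, hφ, x, hx, hrot⟩ := exists_isTest_rot_ne_zero hopen hne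
  have hcont : Continuous (bdryDist Ω) := Metric.continuous_infDist_pt _
  have hw := hφ.rot.hasWeakRot
  have hdr : InL2 Ω (fun x => bdryDist Ω x • rot (rot φ) x) :=
    ((hcont.smul hφ.rot.rot.continuous).memLp_of_hasCompactSupport
      hφ.rot.rot.compact.smul_left).restrict Ω
  have hv0 := sqNorm_ne_zero hopen hφ.rot.continuous hx hrot
  have hle : ∀ P ∈ poincareRotConsts Ω, ‖hφ.rot.inL2.toLp _‖ ^ 2 ≤ P * ‖hdr.toLp _‖ ^ 2 := by
    intro P hP
    have := hP.2 _ _ (orthKerRot_rot hφ) hw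
    rwa [sqNorm_eq_of_inL2 hφ.rot.inL2, sqNorm_eq_of_inL2 hdr, ← ENNReal.ofReal_mul hP.1.le,
      ENNReal.ofReal_le_ofReal_iff (by have := hP.1; positivity)] at this
  rw [sqNorm_eq_of_inL2 hφ.rot.inL2, Ne, ENNReal.ofReal_eq_zero, not_le] at hv0
  obtain ⟨P₀, hP₀⟩ := hP
  have hd0 : 0 < ‖hdr.toLp _‖ ^ 2 := pos_of_mul_pos_right (hv0.trans_le (hle P₀ hP₀)) hP₀.1.le
  exact ⟨_, div_pos hv0 hd0, fun P hP => (div_le_iff₀ hd0).2 (hle P hP)⟩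

/-- For each fixed field the inequality is a closed condition on `P`, so it survives the infimum;
the uniform lower bound keeps the infimum positive. -/
theorem isLeast_poincareRotConst (hopen : IsOpen Ω) (hne : Ω.Nonempty)
    (hP : (poincareRotConsts Ω).Nonempty) :
    IsLeast (poincareRotConsts Ω) (poincareRotConst Ω) := by
  obtain ⟨c, hc, hcle⟩ := exists_pos_le_poincareRotConsts hopen hne hP
  have hpos : 0 < poincareRotConst Ω := hc.trans_le (le_csInf hP hcle)
  have hbdd : BddBelow (poincareRotConsts Ω) := ⟨c, hcle⟩
  refine ⟨⟨hpos, fun v r hv hr => ?_⟩, fun P hP => csInf_le hbdd hP⟩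
  by_cases hfin : sqNorm Ω (fun x => bdryDist Ω x • r x) = ⊤
  · rw [hfin, ENNReal.mul_top (by simpa using hpos)]
    exact le_top
  have hvL : InL2 Ω v := hv.1
  obtain ⟨D, hD⟩ : ∃ D : ℝ, 0 ≤ D ∧ sqNorm Ω (fun x => bdryDist Ω x • r x) = ENNReal.ofReal D :=
    ⟨_, ENNReal.toReal_nonneg, (ENNReal.ofReal_toReal hfin).symm⟩
  have hle : ∀ P ∈ poincareRotConsts Ω, ‖hvL.toLp v‖ ^ 2 ≤ P * D := by
    intro P hP
    have := hP.2 v r hv hr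
    rwa [sqNorm_eq_of_inL2 hvL, hD.2, ← ENNReal.ofReal_mul hP.1.le,
      ENNReal.ofReal_le_ofReal_iff (mul_nonneg hP.1.le hD.1)] at this
  rw [sqNorm_eq_of_inL2 hvL, hD.2, ← ENNReal.ofReal_mul hpos.le]
  refine ENNReal.ofReal_le_ofReal ?_
  -- If `D = 0`, any admissible constant already forces `v = 0` almost everywhere on `Ω`; otherwise
  -- divide by `D`.
  rcases hD.1.eq_or_lt with h | h
  · obtain ⟨P₀, hP₀⟩ := hP
    simpa [← h] using hle P₀ hP₀
  · exact (div_le_iff₀ h).1 (le_csInf hP fun P hP => (div_le_iff₀ h).2 (hle P hP))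

/-- The infima are taken separately, first over `H` and then over `Γ`, so neither needs to be
attained. -/
theorem le_hardyConst_mul {P : ℝ} (hHardy : (hardyConsts Ω).Nonempty)
    (hFV : (friedrichsVelteRotConsts Ω).Nonempty)
    (h : ∀ H ∈ hardyConsts Ω, ∀ Γ ∈ friedrichsVelteRotConsts Ω, P ≤ H * (1 + Γ)) :
    P ≤ hardyConst Ω * (1 + friedrichsVelteRotConst Ω) := by
  have h0 : 0 ≤ friedrichsVelteRotConst Ω := le_csInf hFV fun Γ hΓ => hΓ.1.le
  rw [← div_le_iff₀ (by linarith)]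
  refine le_csInf hHardy fun H hH => ?_
  rw [div_le_iff₀ (by linarith), ← div_le_iff₀' hH.1, ← sub_le_iff_le_add']
  refine le_csInf hFV fun Γ hΓ => ?_
  rw [sub_le_iff_le_add', div_le_iff₀' hH.1]
  exact h H hH Γ hΓ

end Least

end

end RotIneq

theorem mainTheorem4 (Ω : Set RotIneq.E3) (hopen : IsOpen Ω) (hconn : IsConnected Ω)
    (hbdd : Bornology.IsBounded Ω)
    (hHardy : (RotIneq.hardyConsts Ω).Nonempty)
    (hFV : (RotIneq.friedrichsVelteRotConsts Ω).Nonempty) :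
    (∃ P : ℝ, 0 < P ∧ ∀ v r : RotIneq.E3 → RotIneq.E3,
      RotIneq.OrthKerRot Ω v → RotIneq.HasWeakRot Ω v r →
        RotIneq.sqNorm Ω v ≤
          ENNReal.ofReal P * RotIneq.sqNorm Ω (fun x => RotIneq.bdryDist Ω x • r x)) ∧
    IsLeast (RotIneq.poincareRotConsts Ω) (RotIneq.poincareRotConst Ω) ∧
    RotIneq.poincareRotConst Ω ≤
      RotIneq.hardyConst Ω * (1 + RotIneq.friedrichsVelteRotConst Ω) := by
  have hmem := fun H hH Γ hΓ => RotIneq.mul_one_add_mem_poincareRotConsts (H := H) (Γ := Γ)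
    hopen hconn.nonempty hbdd hH hΓ
  obtain ⟨H, hH⟩ := hHardy
  obtain ⟨Γ, hΓ⟩ := hFV
  have hleast := RotIneq.isLeast_poincareRotConst hopen hconn.nonempty ⟨_, hmem H hH Γ hΓ⟩
  exact ⟨⟨_, hmem H hH Γ hΓ⟩, hleast, RotIneq.le_hardyConst_mul ⟨H, hH⟩ ⟨Γ, hΓ⟩
    fun H hH Γ hΓ => hleast.2 (hmem H hH Γ hΓ)⟩
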